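/- **Setting.** A *program variable* $x$ carries a nonempty set $\mathrm{Type}_x$ and a flag (quantum or classical); $V^{\mathrm{qu}}$ denotes the set of quantum variables in a set $V$ of variables. For a set $X$, $\ell^2(X)$ is the Hilbert space of square-summable functions $X\to\mathbb C$. For a set $V$ of variables, $\mathrm{Type}^{\mathrm{set}}_V=\prod_{x\in V}\mathrm{Type}_x$ and $\ell^2[V]:=\ell^2(\mathrm{Type}^{\mathrm{set}}_V)$. For disjoint $V,W$, the tensor product of $\psi\in\ell^2[V]$ and $\phi\in\ell^2[W]$ is $\psi\otimes\phi\in\ell^2[V\cup W]$, $(\psi\otimes\phi)(m)=\psi(m|_V)\,\phi(m|_W)$; for bounded operators $A:\ell^2[V]\to\ell^2[V']$, $B:\ell^2[W]\to\ell^2[W']$ (with $V'$, $W'$ also disjoint), $A\otimes B:\ell^2[V\cup W]\to\ell^2[V'\cup W']$ is the unique bounded operator with $(A\otimes B)(\psi\otimes\phi)=A\psi\otimes B\phi$. For a list $Q=(q_1,\dots,q_n)$ of distinct quantum variables (also regarded as the set of its entries), $\mathrm{Type}^{\mathrm{list}}_Q=\mathrm{Type}_{q_1}\times\dots\times\mathrm{Type}_{q_n}$,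 and $U_Q:\ell^2(\mathrm{Type}^{\mathrm{list}}_Q)\to\ell^2[Q]$ is the canonical unitary induced by the bijection $(a_1,\dots,a_n)\mapsto m$, $m(q_i)=a_i$. **Quantum equality.** Let $Q_1,Q_2\subseteq V^{\mathrm{qu}}$ be disjoint lists of distinct quantum variables, $Z$ a set, and $U_i:\ell^2(\mathrm{Type}^{\mathrm{list}}_{Q_i})\to\ell^2(Z)$ bounded operators ($i=1,2$). Then $(U_1Q_1\equiv_{\mathsf q}U_2Q_2)\subseteq\ell^2[V^{\mathrm{qu}}]$ is the subspace of all vectors fixed by $$\bigl(U_{Q_2}U_2^*U_1U_{Q_1}^*\bigr)\otimes\bigl(U_{Q_1}U_1^*U_2U_{Q_2}^*\bigr)\otimes \mathrm{id}_{V^{\mathrm{qu}}\setminus Q_1Q_2},$$ where the first factor maps $\ell^2[Q_1]\to\ell^2[Q_2]$ and the second maps $\ell^2[Q_2]\to\ell^2[Q_1]$. If $Q_1,Q_2$ have the same length and corresponding entries have equal types, $(Q_1\equiv_{\mathsf q}Q_2):=(\mathrm{id}\,Q_1\equiv_{\mathsf q}\mathrm{id}\,Q_2)$. **Theorem.** Let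 $V_1,V_2$ be disjoint sets of variables and $V=V_1\cup V_2$. Let $\psi_1\in\ell^2[V_1^{\mathrm{qu}}]$ and $\psi_2\in\ell^2[V_2^{\mathrm{qu}}]$ be unit vectors. 1. Let $Q_1\subseteq V_1^{\mathrm{qu}}$ and $Q_2\subseteq V_2^{\mathrm{qu}}$ be lists of distinct quantum variables, $Z$ a set, and $U_i:\ell^2(\mathrm{Type}^{\mathrm{list}}_{Q_i})\to\ell^2(Z)$ linear operators with $\|U_i\|\le1$. Consider the statement (D) there are unit vectors $\psi_1^Q\in\ell^2[Q_1]$, $\psi_1^Y\in\ell^2[V_1^{\mathrm{qu}}\setminus Q_1]$, $\psi_2^Q\in\ell^2[Q_2]$, $\psi_2^Y\in\ell^2[V_2^{\mathrm{qu}}\setminus Q_2]$ such that $U_1U_{Q_1}^*\psi_1^Q=U_2U_{Q_2}^*\psi_2^Q$, $\psi_1=\psi_1^Q\otimes\psi_1^Y$ and $\psi_2=\psi_2^Q\otimes\psi_2^Y$. If $\psi_1\otimes\psi_2\in(U_1Q_1\equiv_{\mathsf q}U_2Q_2)$, then (D) holds. If moreover $U_1,U_2$ are isometries ($U_i^*U_i=\mathrm{id}$),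 then conversely (D) implies $\psi_1\otimes\psi_2\in(U_1Q_1\equiv_{\mathsf q}U_2Q_2)$. 2. Let $Q_1=(q_1,\dots,q_n)\subseteq V_1^{\mathrm{qu}}$ and $Q_2=(q_1',\dots,q_n')\subseteq V_2^{\mathrm{qu}}$ be lists of distinct quantum variables with $\mathrm{Type}_{q_i}=\mathrm{Type}_{q_i'}$ for all $i$. Let $\sigma:Q_2\to Q_1$, $\sigma(q_i')=q_i$, and let $U_\sigma:\ell^2[Q_2]\to\ell^2[Q_1]$ be the unitary that maps the basis vector of $m$ to the basis vector of $m\circ\sigma^{-1}$. Then $\psi_1\otimes\psi_2\in(Q_1\equiv_{\mathsf q}Q_2)$ if and only if there are unit vectors $\psi_1^Q\in\ell^2[Q_1]$, $\psi_1^Y\in\ell^2[V_1^{\mathrm{qu}}\setminus Q_1]$, $\psi_2^Q\in\ell^2[Q_2]$, $\psi_2^Y\in\ell^2[V_2^{\mathrm{qu}}\setminus Q_2]$ such that $\psi_1^Q=U_\sigma\psi_2^Q$, $\psi_1=\psi_1^Q\otimes\psi_1^Y$ and $\psi_2=\psi_2^Q\otimes\psi_2^Y$. -/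

import Mathlib

open ContinuousLinearMap
open scoped lp

universe u v w

noncomputable section

namespace QRHL

/-! ### The Hilbert spaces `ℓ²(X)` of an arbitrary set `X`, and their tensor products -/

/-- The Hilbert space of all square-summable functions `X → ℂ`. -/
abbrev Ell2 (X : Type*) : Type _ := ℓ²(X, ℂ)

theorem memlp_two_iff {X : Type*} {f : X → ℂ} :
    Memℓp f 2 ↔ Summable fun x => ‖f x‖ ^ 2 := by
  rw [memℓp_gen_iff (by norm_num)]
  simp

theorem Ell2.summable_sq {X : Type*} (ψ : Ell2 X) : Summable fun x => ‖ψ x‖ ^ 2 :=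
  memlp_two_iff.1 (lp.memℓp ψ)

theorem Ell2.norm_sq {X : Type*} (ψ : Ell2 X) : ‖ψ‖ ^ 2 = ∑' x, ‖ψ x‖ ^ 2 := by
  have h := lp.norm_rpow_eq_tsum (p := 2) (by norm_num) ψ
  simpa using h

/-- The unitary `ℓ²(X) → ℓ²(Y)` given by relabelling the computational basis along a bijection
`e : X ≃ Y`, i.e. the one that maps the basis vector of `x` to the basis vector of `e x`. -/
def reindex {X Y : Type*} (e : X ≃ Y) : Ell2 X ≃ₗᵢ[ℂ] Ell2 Y where
  toFun ψ := ⟨fun y => ψ (e.symm y), memlp_two_iff.2 (ψ.summable_sq.comp_injective e.symm.injective)⟩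
  invFun φ := ⟨fun x => φ (e x), memlp_two_iff.2 (φ.summable_sq.comp_injective e.injective)⟩
  left_inv ψ := by ext x; exact congrArg (ψ : X → ℂ) (e.symm_apply_apply x)
  right_inv φ := by ext y; exact congrArg (φ : Y → ℂ) (e.apply_symm_apply y)
  map_add' _ _ := rfl
  map_smul' _ _ := rfl
  norm_map' ψ := by
    refine (sq_eq_sq₀ (norm_nonneg _) (norm_nonneg _)).1 ?_
    rw [Ell2.norm_sq, Ell2.norm_sq]
    exact e.symm.tsum_eq (fun x => ‖ψ x‖ ^ 2)

theorem reindex_apply {X Y : Type*} (e : X ≃ Y) (ψ : Ell2 X) (y : Y) :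
    reindex e ψ y = ψ (e.symm y) := rfl

/-- The elementary tensor `(x, y) ↦ ψ x * φ y` in `ℓ²(X × Y)`. -/
def prodVec {X Y : Type*} (ψ : Ell2 X) (φ : Ell2 Y) : Ell2 (X × Y) :=
  ⟨fun p => ψ p.1 * φ p.2, memlp_two_iff.2 <| by
    have h := ψ.summable_sq.mul_of_nonneg φ.summable_sq (fun _ => by positivity)
      (fun _ => by positivity)
    simpa only [norm_mul, mul_pow] using h⟩

theorem prodVec_apply {X Y : Type*} (ψ : Ell2 X) (φ : Ell2 Y) (p : X × Y) :
    prodVec ψ φ p = ψ p.1 * φ p.2 := rfl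

/-- The slice `x ↦ ψ (x, y)` of a vector of `ℓ²(X × Y)`. -/
def slice {X Y : Type*} (ψ : Ell2 (X × Y)) (y : Y) : Ell2 X :=
  ⟨fun x => ψ (x, y), memlp_two_iff.2
    (ψ.summable_sq.comp_injective (i := fun x => (x, y)) (fun _ _ h => (Prod.mk.inj h).1))⟩

theorem slice_summable {X Y : Type*} (ψ : Ell2 (X × Y)) :
    Summable fun y => ‖slice ψ y‖ ^ 2 := by
  have h := ((Equiv.prodComm Y X).summable_iff.2 ψ.summable_sq).prod
  refine h.congr fun y => ?_
  rw [Ell2.norm_sq]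
  rfl

theorem slice_tsum {X Y : Type*} (ψ : Ell2 (X × Y)) :
    ∑' y, ‖slice ψ y‖ ^ 2 = ‖ψ‖ ^ 2 := by
  have hs := (Equiv.prodComm Y X).summable_iff.2 ψ.summable_sq
  rw [Ell2.norm_sq ψ, ← (Equiv.prodComm Y X).tsum_eq]
  simp only [Ell2.norm_sq]
  exact (hs.tsum_prod).symm

theorem slice_op_bound {X X' : Type*} (A : Ell2 X →L[ℂ] Ell2 X') (φ : Ell2 X) :
    ‖A φ‖ ^ 2 ≤ ‖A‖ ^ 2 * ‖φ‖ ^ 2 := by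
  rw [← mul_pow]
  exact pow_le_pow_left₀ (norm_nonneg _) (A.le_opNorm φ) 2

theorem slice_op_summable {X X' Y : Type*} (A : Ell2 X →L[ℂ] Ell2 X') (ψ : Ell2 (X × Y)) :
    Summable fun p : Y × X' => ‖A (slice ψ p.1) p.2‖ ^ 2 := by
  refine (summable_prod_of_nonneg (fun _ => by positivity)).2
    ⟨fun y => (A (slice ψ y)).summable_sq, ?_⟩
  simp only [← Ell2.norm_sq]
  exact Summable.of_nonneg_of_le (fun _ => by positivity)
    (fun y => slice_op_bound A (slice ψ y)) ((slice_summable ψ).mul_left _)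

/-- The operator `A ⊗ id : ℓ²(X × Y) → ℓ²(X' × Y)`, which applies `A` to every slice. -/
def opFst {X X' : Type*} (Y : Type*) (A : Ell2 X →L[ℂ] Ell2 X') :
    Ell2 (X × Y) →L[ℂ] Ell2 (X' × Y) :=
  LinearMap.mkContinuous
    { toFun := fun ψ => ⟨fun p => A (slice ψ p.2) p.1, memlp_two_iff.2
        ((Equiv.prodComm X' Y).summable_iff.2 (slice_op_summable A ψ))⟩
      map_add' := fun ψ φ => by
        ext p
        have h : slice (ψ + φ) p.2 = slice ψ p.2 + slice φ p.2 := rfl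
        change A (slice (ψ + φ) p.2) p.1 = A (slice ψ p.2) p.1 + A (slice φ p.2) p.1
        rw [h, map_add]; rfl
      map_smul' := fun c ψ => by
        ext p
        have h : slice (c • ψ) p.2 = c • slice ψ p.2 := rfl
        change A (slice (c • ψ) p.2) p.1 = c • A (slice ψ p.2) p.1
        rw [h, map_smul]; rfl }
    ‖A‖ <| fun ψ => by
      refine (sq_le_sq₀ (norm_nonneg _) (by positivity)).1 ?_
      rw [Ell2.norm_sq, mul_pow, ← slice_tsum ψ, ← tsum_mul_left,
        ← (Equiv.prodComm Y X').tsum_eq]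
      have hs := slice_op_summable A ψ
      refine (hs.tsum_prod).trans_le ?_
      simp only [← Ell2.norm_sq]
      have hle := fun y => slice_op_bound A (slice ψ y)
      exact Summable.tsum_le_tsum hle (Summable.of_nonneg_of_le (fun _ => by positivity) hle
        ((slice_summable ψ).mul_left _)) ((slice_summable ψ).mul_left _)

theorem opFst_apply {X X' Y : Type*} (A : Ell2 X →L[ℂ] Ell2 X') (ψ : Ell2 (X × Y))
    (p : X' × Y) : opFst Y A ψ p = A (slice ψ p.2) p.1 := rfl

theorem opFst_prodVec {X X' Y : Type*} (A : Ell2 X →L[ℂ] Ell2 X') (ψ : Ell2 X) (φ : Ell2 Y) :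
    opFst Y A (prodVec ψ φ) = prodVec (A ψ) φ := by
  ext p
  have h : slice (prodVec ψ φ) p.2 = φ p.2 • ψ := by
    ext x; exact mul_comm _ _
  rw [opFst_apply, h, map_smul, prodVec_apply]
  exact mul_comm _ _

/-- The bounded operator `A ⊗ B : ℓ²(X × Y) → ℓ²(X' × Y')`, as `(id ⊗ B)(A ⊗ id)`. -/
def prodOp {X X' Y Y' : Type*} (A : Ell2 X →L[ℂ] Ell2 X') (B : Ell2 Y →L[ℂ] Ell2 Y') :
    Ell2 (X × Y) →L[ℂ] Ell2 (X' × Y') :=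
  (reindex (Equiv.prodComm Y' X') : Ell2 (Y' × X') →L[ℂ] Ell2 (X' × Y')) ∘L opFst X' B ∘L
    (reindex (Equiv.prodComm X' Y) : Ell2 (X' × Y) →L[ℂ] Ell2 (Y × X')) ∘L opFst Y A

theorem prodOp_prodVec {X X' Y Y' : Type*} (A : Ell2 X →L[ℂ] Ell2 X')
    (B : Ell2 Y →L[ℂ] Ell2 Y') (ψ : Ell2 X) (φ : Ell2 Y) :
    prodOp A B (prodVec ψ φ) = prodVec (A ψ) (B φ) := by
  have swap' : ∀ (ψ : Ell2 Y') (φ : Ell2 X'),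
      reindex (Equiv.prodComm Y' X') (prodVec ψ φ) = prodVec φ ψ := by
    intro ψ φ
    ext p
    exact mul_comm _ _
  have swap'' : ∀ (ψ : Ell2 X') (φ : Ell2 Y),
      reindex (Equiv.prodComm X' Y) (prodVec ψ φ) = prodVec φ ψ := by
    intro ψ φ
    ext p
    exact mul_comm _ _
  change reindex (Equiv.prodComm Y' X') (opFst X' B (reindex (Equiv.prodComm X' Y)
    (opFst Y A (prodVec ψ φ)))) = _
  rw [opFst_prodVec, swap'', opFst_prodVec, swap']

/-- A bounded operator on `ℓ²(X × Y)` is determined by its values on elementary tensors. -/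
theorem op_ext_prodVec {X Y : Type*} {E : Type*} [NormedAddCommGroup E] [NormedSpace ℂ E]
    {S T : Ell2 (X × Y) →L[ℂ] E} (h : ∀ ψ φ, S (prodVec ψ φ) = T (prodVec ψ φ)) : S = T := by
  classical
  ext ξ
  have hξ := lp.hasSum_single (p := 2) (by norm_num) ξ
  refine (S.hasSum hξ).unique ?_
  convert T.hasSum hξ using 2 with p
  have : lp.single 2 p (ξ p) =
      prodVec (lp.single 2 p.1 (ξ p) : Ell2 X) (lp.single 2 p.2 (1 : ℂ) : Ell2 Y) := by
    ext q
    rw [prodVec_apply]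
    by_cases h1 : q.1 = p.1 <;> by_cases h2 : q.2 = p.2 <;>
      simp [lp.single_apply, Pi.single_apply, Prod.ext_iff, h1, h2]
  change S (lp.single 2 p (ξ p)) = T (lp.single 2 p (ξ p))
  rw [this, h]

/-! ### Program variables -/

/-- A collection of program variables: every variable carries a nonempty type and a flag telling
whether it is quantum or classical. -/
structure ProgVars where
  Var : Type u
  typ : Var → Type v
  typ_nonempty : ∀ x, Nonempty (typ x)
  isQuantum : Var → Prop

namespace ProgVars

variable (𝒱 : ProgVars.{u, v})

/-- The quantum variables in `V`. -/
def qu (V : Set 𝒱.Var) : Set 𝒱.Var := {x ∈ V | 𝒱.isQuantum x}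

/-- The memories over `V`: assignments of a value of the right type to each variable in `V`. -/
abbrev types (V : Set 𝒱.Var) : Type _ := ∀ x : V, 𝒱.typ x

/-- The pure quantum states over a set `V` of variables (before normalization). -/
abbrev Ell2V (V : Set 𝒱.Var) : Type _ := Ell2 (𝒱.types V)

variable {𝒱}

/-- `W` is the disjoint union of `X` and `Y`, i.e. `W = XY` with `X`, `Y` disjoint. -/
structure Splits (X Y W : Set 𝒱.Var) : Prop where
  disjoint : Disjoint X Y
  union_eq : X ∪ Y = W

namespace Splits

variable {X Y W : Set 𝒱.Var}

theorem left_subset (h : Splits X Y W) : X ⊆ W := h.union_eq ▸ Set.subset_union_left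

theorem right_subset (h : Splits X Y W) : Y ⊆ W := h.union_eq ▸ Set.subset_union_right

theorem symm (h : Splits X Y W) : Splits Y X W :=
  ⟨h.disjoint.symm, by rw [Set.union_comm, h.union_eq]⟩

theorem mem_right (h : Splits X Y W) {x : 𝒱.Var} (hx : x ∈ W) (hX : x ∉ X) : x ∈ Y := by
  rw [← h.union_eq] at hx
  exact hx.resolve_left hX

theorem of_subset (h : X ⊆ W) : Splits X (W \ X) W :=
  ⟨disjoint_sdiff_self_right, Set.union_sdiff_cancel h⟩

theorem of_disjoint (h : Disjoint X Y) : Splits X Y (X ∪ Y) := ⟨h, rfl⟩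

open Classical in
/-- The identification of memories over `W = XY` with pairs of memories: `m ↦ (m|X, m|Y)`,
with inverse `(m₁, m₂) ↦ m₁ ∪ m₂`. -/
def memEquiv (h : Splits X Y W) : 𝒱.types W ≃ 𝒱.types X × 𝒱.types Y where
  toFun m := (fun x => m ⟨x, h.left_subset x.2⟩, fun y => m ⟨y, h.right_subset y.2⟩)
  invFun p := fun x =>
    if hx : (x : 𝒱.Var) ∈ X then p.1 ⟨x, hx⟩ else p.2 ⟨x, h.mem_right x.2 hx⟩
  left_inv m := by
    funext x
    by_cases hx : (x : 𝒱.Var) ∈ X <;> simp [hx]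
  right_inv p := by
    refine Prod.ext ?_ ?_
    · funext x
      simp
    · funext y
      exact dif_neg (h.disjoint.notMem_of_mem_right y.2)

/-- The tensor product `ψ ⊗ φ ∈ ℓ²[XY]` of `ψ ∈ ℓ²[X]` and `φ ∈ ℓ²[Y]`. -/
def tensor (h : Splits X Y W) (ψ : 𝒱.Ell2V X) (φ : 𝒱.Ell2V Y) : 𝒱.Ell2V W :=
  reindex h.memEquiv.symm (prodVec ψ φ)

theorem tensor_apply (h : Splits X Y W) (ψ : 𝒱.Ell2V X) (φ : 𝒱.Ell2V Y) (m : 𝒱.types W) :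
    h.tensor ψ φ m = ψ (fun x => m ⟨x, h.left_subset x.2⟩) *
      φ (fun y => m ⟨y, h.right_subset y.2⟩) := rfl

variable {X' Y' W' : Set 𝒱.Var}

/-- The tensor product `A ⊗ B : ℓ²[XY] → ℓ²[X'Y']` of bounded operators `A : ℓ²[X] → ℓ²[X']`
and `B : ℓ²[Y] → ℓ²[Y']`. -/
def opTensor (h : Splits X Y W) (h' : Splits X' Y' W')
    (A : 𝒱.Ell2V X →L[ℂ] 𝒱.Ell2V X') (B : 𝒱.Ell2V Y →L[ℂ] 𝒱.Ell2V Y') :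
    𝒱.Ell2V W →L[ℂ] 𝒱.Ell2V W' :=
  (reindex h'.memEquiv.symm : Ell2 (𝒱.types X' × 𝒱.types Y') →L[ℂ] 𝒱.Ell2V W') ∘L
    prodOp A B ∘L (reindex h.memEquiv : 𝒱.Ell2V W →L[ℂ] Ell2 (𝒱.types X × 𝒱.types Y))

/-- `A ⊗ B` satisfies `(A ⊗ B)(ψ ⊗ φ) = Aψ ⊗ Bφ`, and is the only bounded operator that does. -/
theorem eq_opTensor_iff (h : Splits X Y W) (h' : Splits X' Y' W')
    (A : 𝒱.Ell2V X →L[ℂ] 𝒱.Ell2V X') (B : 𝒱.Ell2V Y →L[ℂ] 𝒱.Ell2V Y')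
    (C : 𝒱.Ell2V W →L[ℂ] 𝒱.Ell2V W') :
    C = opTensor h h' A B ↔ ∀ ψ φ, C (h.tensor ψ φ) = h'.tensor (A ψ) (B φ) := by
  have key : ∀ ψ φ, opTensor h h' A B (h.tensor ψ φ) = h'.tensor (A ψ) (B φ) := by
    intro ψ φ
    change reindex h'.memEquiv.symm (prodOp A B (reindex h.memEquiv
      (reindex h.memEquiv.symm (prodVec ψ φ)))) = _
    have h1 : reindex h.memEquiv (reindex h.memEquiv.symm (prodVec ψ φ)) = prodVec ψ φ :=
      (reindex h.memEquiv).apply_symm_apply _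
    rw [h1, prodOp_prodVec]
    rfl
  constructor
  · rintro rfl
    exact key
  · intro hC
    have h2 : C ∘L (reindex h.memEquiv.symm :
          Ell2 (𝒱.types X × 𝒱.types Y) →L[ℂ] 𝒱.Ell2V W) =
        opTensor h h' A B ∘L (reindex h.memEquiv.symm :
          Ell2 (𝒱.types X × 𝒱.types Y) →L[ℂ] 𝒱.Ell2V W) := by
      refine op_ext_prodVec fun ψ φ => ?_
      rw [ContinuousLinearMap.comp_apply, ContinuousLinearMap.comp_apply]
      exact (hC ψ φ).trans (key ψ φ).symm
    ext1 ξ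
    obtain ⟨ζ, rfl⟩ := (reindex h.memEquiv.symm).surjective ξ
    exact DFunLike.congr_fun h2 ζ

end Splits

/-- Variable renamings: bijections that preserve types and the quantum/classical flag. -/
structure Renaming (X Y : Set 𝒱.Var) where
  toEquiv : X ≃ Y
  typ_eq : ∀ x, 𝒱.typ (toEquiv x) = 𝒱.typ x
  isQuantum_iff : ∀ x, 𝒱.isQuantum (toEquiv x) ↔ 𝒱.isQuantum x

namespace Renaming

variable {X Y : Set 𝒱.Var}

/-- The map `m ↦ m ∘ σ⁻¹` from memories over `X` to memories over `Y`. -/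
def memEquiv (σ : Renaming X Y) : 𝒱.types X ≃ 𝒱.types Y :=
  Equiv.piCongr σ.toEquiv fun x => Equiv.cast (σ.typ_eq x).symm

theorem memEquiv_apply (σ : Renaming X Y) (m : 𝒱.types X) (x : X) :
    σ.memEquiv m (σ.toEquiv x) = cast (σ.typ_eq x).symm (m x) :=
  Equiv.piCongr_apply_apply _ _ _ _

/-- The unitary `ℓ²[X] → ℓ²[Y]` that maps the basis vector of `m` to that of `m ∘ σ⁻¹`. -/
def unitary (σ : Renaming X Y) : 𝒱.Ell2V X →L[ℂ] 𝒱.Ell2V Y := reindex σ.memEquiv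

end Renaming

variable (𝒱)

/-- Lists of `n` distinct quantum variables. -/
structure QList (n : ℕ) where
  get : Fin n → 𝒱.Var
  injective : Function.Injective get
  isQuantum : ∀ i, 𝒱.isQuantum (get i)

variable {𝒱}

namespace QList

variable {n n₁ n₂ : ℕ}

/-- The set of the variables in a list. -/
def vars (Q : 𝒱.QList n) : Set 𝒱.Var := Set.range Q.get

/-- The type of a list of variables: the product of the types of its entries. -/
abbrev typel (Q : 𝒱.QList n) : Type _ := ∀ i : Fin n, 𝒱.typ (Q.get i)

/-- The positions of a list of distinct variables correspond to its variables. -/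
def idx (Q : 𝒱.QList n) : Fin n ≃ Q.vars := Equiv.ofInjective Q.get Q.injective

theorem idx_coe (Q : 𝒱.QList n) (i : Fin n) : (Q.idx i : 𝒱.Var) = Q.get i := rfl

/-- The bijection that maps `(q₁, …, qₙ)` to the memory `m` with `m (Q i) = qᵢ`. -/
def memEquiv (Q : 𝒱.QList n) : Q.typel ≃ 𝒱.types Q.vars :=
  Equiv.piCongrLeft (fun x : Q.vars => 𝒱.typ x) Q.idx

theorem memEquiv_apply (Q : 𝒱.QList n) (q : Q.typel) (i : Fin n) :
    Q.memEquiv q (Q.idx i) = q i :=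
  Equiv.piCongrLeft_apply_apply (fun x : Q.vars => 𝒱.typ x) Q.idx q i

/-- The canonical unitary from `ℓ²` of the type of `Q` to `ℓ²[Q]`. -/
def unitary (Q : 𝒱.QList n) : Ell2 Q.typel →L[ℂ] 𝒱.Ell2V Q.vars := reindex Q.memEquiv

/-- The operator
`(U_{Q₂} U₂* U₁ U_{Q₁}*) ⊗ (U_{Q₁} U₁* U₂ U_{Q₂}*) ⊗ id` on `ℓ²[V]`, for lists `Q₁`, `Q₂`
of variables in `V`. The first factor maps `ℓ²[Q₁]` to `ℓ²[Q₂]`, the second one `ℓ²[Q₂]` to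
`ℓ²[Q₁]`, the third one is the identity on the remaining variables. -/
def swapOp {Z : Type*} (V : Set 𝒱.Var) (Q₁ : 𝒱.QList n₁) (Q₂ : 𝒱.QList n₂)
    (hdisj : Disjoint Q₁.vars Q₂.vars) (hsub : Q₁.vars ∪ Q₂.vars ⊆ V)
    (U₁ : Ell2 Q₁.typel →L[ℂ] Ell2 Z) (U₂ : Ell2 Q₂.typel →L[ℂ] Ell2 Z) :
    𝒱.Ell2V V →L[ℂ] 𝒱.Ell2V V :=
  Splits.opTensor (Splits.of_subset hsub) (Splits.of_subset hsub)
    (Splits.opTensor (Splits.of_disjoint hdisj) (Splits.of_disjoint hdisj).symm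
      (Q₂.unitary ∘L adjoint U₂ ∘L U₁ ∘L adjoint Q₁.unitary)
      (Q₁.unitary ∘L adjoint U₁ ∘L U₂ ∘L adjoint Q₂.unitary))
    (ContinuousLinearMap.id ℂ (𝒱.Ell2V (V \ (Q₁.vars ∪ Q₂.vars))))

/-- The quantum equality `U₁Q₁ ≡q U₂Q₂`, for disjoint lists `Q₁`, `Q₂` of distinct quantum
variables in `V`: the (closed) subspace of `ℓ²[V^qu]` fixed by `swapOp`. -/
def quantEq {Z : Type*} (V : Set 𝒱.Var) (Q₁ : 𝒱.QList n₁) (Q₂ : 𝒱.QList n₂)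
    (hdisj : Disjoint Q₁.vars Q₂.vars) (hsub : Q₁.vars ∪ Q₂.vars ⊆ 𝒱.qu V)
    (U₁ : Ell2 Q₁.typel →L[ℂ] Ell2 Z) (U₂ : Ell2 Q₂.typel →L[ℂ] Ell2 Z) :
    Submodule ℂ (𝒱.Ell2V (𝒱.qu V)) where
  carrier := {ψ | swapOp (𝒱.qu V) Q₁ Q₂ hdisj hsub U₁ U₂ ψ = ψ}
  add_mem' := fun {a b} ha hb => by
    change swapOp (𝒱.qu V) Q₁ Q₂ hdisj hsub U₁ U₂ (a + b) = a + b
    rw [map_add]; exact congrArg₂ (· + ·) ha hb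
  zero_mem' := map_zero _
  smul_mem' := fun c a ha => by
    change swapOp (𝒱.qu V) Q₁ Q₂ hdisj hsub U₁ U₂ (c • a) = c • a
    rw [map_smul]; exact congrArg (c • ·) ha

/-- If corresponding entries of `Q₁` and `Q₂` have the same type, then the types of the lists
are equal; this is the identity of `ℓ²` of that common type, seen as a map from `ℓ²` of the type
of `Q₂` to `ℓ²` of the type of `Q₁`. -/
def idTypel {Q₁ Q₂ : 𝒱.QList n} (h : ∀ i, 𝒱.typ (Q₁.get i) = 𝒱.typ (Q₂.get i)) :
    Ell2 Q₂.typel →L[ℂ] Ell2 Q₁.typel :=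
  reindex (Equiv.piCongrRight fun i => Equiv.cast (h i).symm)

/-- The quantum equality `Q₁ ≡q Q₂`, which is `id Q₁ ≡q id Q₂`. -/
def quantEqSimple (V : Set 𝒱.Var) (Q₁ Q₂ : 𝒱.QList n)
    (htyp : ∀ i, 𝒱.typ (Q₁.get i) = 𝒱.typ (Q₂.get i))
    (hdisj : Disjoint Q₁.vars Q₂.vars) (hsub : Q₁.vars ∪ Q₂.vars ⊆ 𝒱.qu V) :
    Submodule ℂ (𝒱.Ell2V (𝒱.qu V)) :=
  quantEq V Q₁ Q₂ hdisj hsub (ContinuousLinearMap.id ℂ (Ell2 Q₁.typel)) (idTypel htyp)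

/-- The variable renaming `σ : Q₂ → Q₁` that maps the `i`-th variable of `Q₂` to the `i`-th
variable of `Q₁`. -/
def toRenaming (Q₁ Q₂ : 𝒱.QList n) (htyp : ∀ i, 𝒱.typ (Q₁.get i) = 𝒱.typ (Q₂.get i)) :
    Renaming Q₂.vars Q₁.vars where
  toEquiv := Q₂.idx.symm.trans Q₁.idx
  typ_eq x := by
    obtain ⟨i, rfl⟩ := Q₂.idx.surjective x
    simpa [idx_coe] using htyp i
  isQuantum_iff x := by
    obtain ⟨i, rfl⟩ := Q₂.idx.surjective x
    simpa [idx_coe] using iff_of_true (Q₁.isQuantum i) (Q₂.isQuantum i)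

theorem toRenaming_apply (Q₁ Q₂ : 𝒱.QList n)
    (htyp : ∀ i, 𝒱.typ (Q₁.get i) = 𝒱.typ (Q₂.get i)) (i : Fin n) :
    (toRenaming Q₁ Q₂ htyp).toEquiv (Q₂.idx i) = Q₁.idx i := by
  simp [toRenaming]

end QList

theorem qu_splits {V₁ V₂ : Set 𝒱.Var} (h : Disjoint V₁ V₂) :
    Splits (𝒱.qu V₁) (𝒱.qu V₂) (𝒱.qu (V₁ ∪ V₂)) where
  disjoint := h.mono (fun _ hx => hx.1) (fun _ hx => hx.1)
  union_eq := by
    ext x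
    simp only [qu, Set.mem_union, Set.mem_ofPred_eq]
    tauto

theorem qlist_disjoint {n₁ n₂ : ℕ} {V₁ V₂ : Set 𝒱.Var} (h : Disjoint V₁ V₂)
    {Q₁ : 𝒱.QList n₁} {Q₂ : 𝒱.QList n₂}
    (h₁ : Q₁.vars ⊆ 𝒱.qu V₁) (h₂ : Q₂.vars ⊆ 𝒱.qu V₂) : Disjoint Q₁.vars Q₂.vars :=
  (qu_splits h).disjoint.mono h₁ h₂

theorem qlist_subset {n₁ n₂ : ℕ} {V₁ V₂ : Set 𝒱.Var} (h : Disjoint V₁ V₂)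
    {Q₁ : 𝒱.QList n₁} {Q₂ : 𝒱.QList n₂}
    (h₁ : Q₁.vars ⊆ 𝒱.qu V₁) (h₂ : Q₂.vars ⊆ 𝒱.qu V₂) :
    Q₁.vars ∪ Q₂.vars ⊆ 𝒱.qu (V₁ ∪ V₂) :=
  Set.union_subset (h₁.trans (qu_splits h).left_subset) (h₂.trans (qu_splits h).right_subset)

end ProgVars

end QRHL

end

/-!
Put `Tᵢ = Uᵢ U_{Qᵢ}*`, a contraction `ℓ²[Qᵢ] → ℓ²(Z)`. The operator defining the quantum equality acts
as `T₂* T₁ ⊗ T₁* T₂` on the variables in `Q₁ Q₂` and as the identity on all others, so it can be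
computed slice by slice, a slice being the restriction of a state to a fixed assignment of the
other variables. For a product state `ψ₁ ⊗ ψ₂`, being fixed means (`swapOp_tensor_apply`) that
for every slice `s₁` of `ψ₁` and every slice `s₂` of `ψ₂`
`T₁* T₂ s₂ ⊗ T₂* T₁ s₁ = s₁ ⊗ s₂`.

Holding a nonzero `s₂` fixed, this exhibits every `s₁` as a multiple of the single vector
`T₁* T₂ s₂`, and symmetrically for `ψ₂`. Hence `ψ₁ = α₁ ⊗ β₁` and `ψ₂ = α₂ ⊗ β₂` with unit vectors
satisfying `T₁* T₂ α₂ ⊗ T₂* T₁ α₁ = α₁ ⊗ α₂`. As all operators are contractions, both factors on the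
left are unit vectors, so `α₂` and `T₂* T₁ α₁` differ by a phase only. Moving that phase into `β₂`
gives `α₂ = T₂* T₁ α₁`, and then equality holds in the Cauchy–Schwarz inequality for
`⟪T₂ α₂, T₁ α₁⟫ = ‖α₂‖² = 1`, which forces `T₂ α₂ = T₁ α₁`. No Schmidt decomposition is needed.
This is `exists_prodVec_of_fixed`.

Conversely, if the `Uᵢ` are isometries, `T₁ α₁ = T₂ α₂` gives `T₂* T₁ α₁ = α₂` and
`T₁* T₂ α₂ = α₁`, and the slice formula shows that the state is fixed. The case `Q₁ ≡q Q₂` is the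
case of two unitaries, where the condition `T₁ α₁ = T₂ α₂` says that `α₁` is the renamed `α₂`.
-/

namespace QRHL

/-! ### Elementary tensors in `ℓ²(X × Y)` -/

theorem slice_prodVec {X Y : Type*} (ψ : Ell2 X) (φ : Ell2 Y) (y : Y) :
    slice (prodVec ψ φ) y = φ y • ψ := by
  ext x; exact mul_comm _ _

theorem norm_prodVec {X Y : Type*} (ψ : Ell2 X) (φ : Ell2 Y) :
    ‖prodVec ψ φ‖ = ‖ψ‖ * ‖φ‖ := by
  refine (sq_eq_sq₀ (norm_nonneg _) (by positivity)).1 ?_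
  rw [mul_pow, ← slice_tsum, Ell2.norm_sq φ, ← tsum_mul_left]
  refine tsum_congr fun y => ?_
  rw [slice_prodVec, norm_smul, mul_pow, mul_comm]

theorem Ell2.exists_apply_ne_zero {X : Type*} {ψ : Ell2 X} (h : ψ ≠ 0) : ∃ x, ψ x ≠ 0 := by
  by_contra! hc
  exact h (lp.ext (funext hc))

theorem Ell2.ne_zero_of_norm_eq_one {X : Type*} {ψ : Ell2 X} (h : ‖ψ‖ = 1) : ψ ≠ 0 :=
  norm_ne_zero_iff.1 (by rw [h]; exact one_ne_zero)

/-- A unit vector all of whose slices lie on one line is an elementary tensor of unit vectors. -/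
theorem exists_eq_prodVec {X Y : Type*} {ψ : Ell2 (X × Y)} (hψ : ‖ψ‖ = 1) (α : Ell2 X)
    (h : ∀ y, ∃ c : ℂ, slice ψ y = c • α) :
    ∃ (β : Ell2 X) (γ : Ell2 Y), ‖β‖ = 1 ∧ ‖γ‖ = 1 ∧ ψ = prodVec β γ := by
  choose c hc using h
  have hα : ‖α‖ ≠ 0 := by
    intro h0
    rw [norm_eq_zero] at h0
    obtain ⟨p, hp⟩ := Ell2.exists_apply_ne_zero (Ell2.ne_zero_of_norm_eq_one hψ)
    have h1 : slice ψ p.2 p.1 = 0 := by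
      rw [hc, h0, smul_zero]; rfl
    exact hp h1
  let γ : Ell2 Y := ⟨fun y => c y * ‖α‖, memlp_two_iff.2 <| by
    refine (slice_summable ψ).congr fun y => ?_
    rw [hc, norm_smul, norm_mul, Complex.norm_real, norm_norm]⟩
  have hβ : ‖(‖α‖ : ℂ)⁻¹ • α‖ = 1 := by
    rw [norm_smul, norm_inv, Complex.norm_real, norm_norm, inv_mul_cancel₀ hα]
  have hprod : ψ = prodVec ((‖α‖ : ℂ)⁻¹ • α) γ := by
    ext p
    have h1 : ψ p = c p.2 * α p.1 := congrArg (fun f : Ell2 X => f p.1) (hc p.2)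
    have h2 : (‖α‖ : ℂ) ≠ 0 := Complex.ofReal_ne_zero.2 hα
    change ψ p = ((‖α‖ : ℂ)⁻¹ * α p.1) * (c p.2 * ‖α‖)
    rw [h1]
    field_simp
  refine ⟨_, γ, hβ, ?_, hprod⟩
  rw [hprod, norm_prodVec, hβ, one_mul] at hψ
  exact hψ

/-! ### Product vectors fixed by `T₂* T₁ ⊗ T₁* T₂` -/

theorem norm_adjoint_apply_le_one {E F G : Type*} [NormedAddCommGroup E] [InnerProductSpace ℂ E]
    [CompleteSpace E] [NormedAddCommGroup F] [InnerProductSpace ℂ F]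
    [NormedAddCommGroup G] [InnerProductSpace ℂ G] [CompleteSpace G]
    {S : E →L[ℂ] G} {T : F →L[ℂ] G} (hS : ‖S‖ ≤ 1) (hT : ‖T‖ ≤ 1) {x : F} (hx : ‖x‖ = 1) :
    ‖adjoint S (T x)‖ ≤ 1 := by
  have h1 : ‖T x‖ ≤ 1 := by simpa [hx] using T.le_of_opNorm_le hT x
  have h2 : ‖adjoint S (T x)‖ ≤ 1 * ‖T x‖ :=
    (adjoint S).le_of_opNorm_le ((LinearIsometryEquiv.norm_map adjoint S).trans_le hS) _
  linarith

/-- Equality in the Cauchy–Schwarz inequality forces `T₂` to map `T₂* T₁ α` back to `T₁ α`. -/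
theorem apply_adjoint_apply_eq {E F G : Type*} [NormedAddCommGroup E] [InnerProductSpace ℂ E]
    [NormedAddCommGroup F] [InnerProductSpace ℂ F] [CompleteSpace F]
    [NormedAddCommGroup G] [InnerProductSpace ℂ G] [CompleteSpace G]
    {T₁ : E →L[ℂ] G} {T₂ : F →L[ℂ] G} (h₁ : ‖T₁‖ ≤ 1) (h₂ : ‖T₂‖ ≤ 1) {α : E} (hα : ‖α‖ = 1)
    (h : ‖adjoint T₂ (T₁ α)‖ = 1) : T₂ (adjoint T₂ (T₁ α)) = T₁ α := by
  set β := adjoint T₂ (T₁ α) with hβ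
  have n1 : ‖T₁ α‖ ≤ 1 := by simpa [hα] using T₁.le_of_opNorm_le h₁ α
  have n2 : ‖T₂ β‖ ≤ 1 := by simpa [h] using T₂.le_of_opNorm_le h₂ β
  have hin : inner ℂ (T₂ β) (T₁ α) = 1 := by
    rw [← adjoint_inner_right, ← hβ, inner_self_eq_norm_sq_to_K, h]
    simp
  have hsq := norm_sub_sq (𝕜 := ℂ) (T₂ β) (T₁ α)
  rw [hin] at hsq
  have h0 : ‖T₂ β - T₁ α‖ ^ 2 ≤ 0 := by
    rw [hsq]
    have := pow_le_one₀ (n := 2) (norm_nonneg _) n1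
    have := pow_le_one₀ (n := 2) (norm_nonneg _) n2
    simp only [RCLike.one_re]
    linarith
  exact sub_eq_zero.1 (norm_eq_zero.1 (pow_eq_zero_iff two_ne_zero |>.1
    (le_antisymm h0 (sq_nonneg _))))

/-- The Hilbert space core of the factorization: the hypothesis `h` says, in coordinates, that
`ψ₁ ⊗ ψ₂` is fixed by `T₂* T₁ ⊗ T₁* T₂ ⊗ id`, where the first two factors exchange `ℓ²(X₁)` and
`ℓ²(X₂)`. -/
theorem exists_prodVec_of_fixed {X₁ Y₁ X₂ Y₂ Z : Type*} {ψ₁ : Ell2 (X₁ × Y₁)}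
    {ψ₂ : Ell2 (X₂ × Y₂)} (hψ₁ : ‖ψ₁‖ = 1) (hψ₂ : ‖ψ₂‖ = 1)
    {T₁ : Ell2 X₁ →L[ℂ] Ell2 Z} {T₂ : Ell2 X₂ →L[ℂ] Ell2 Z} (hT₁ : ‖T₁‖ ≤ 1) (hT₂ : ‖T₂‖ ≤ 1)
    (h : ∀ x₁ y₁ x₂ y₂, adjoint T₁ (T₂ (slice ψ₂ y₂)) x₁ * adjoint T₂ (T₁ (slice ψ₁ y₁)) x₂ =
      ψ₁ (x₁, y₁) * ψ₂ (x₂, y₂)) :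
    ∃ (α₁ : Ell2 X₁) (β₁ : Ell2 Y₁) (α₂ : Ell2 X₂) (β₂ : Ell2 Y₂),
      ‖α₁‖ = 1 ∧ ‖β₁‖ = 1 ∧ ‖α₂‖ = 1 ∧ ‖β₂‖ = 1 ∧ T₁ α₁ = T₂ α₂ ∧
      ψ₁ = prodVec α₁ β₁ ∧ ψ₂ = prodVec α₂ β₂ := by
  -- A nonzero value of one state shows that all slices of the other one are proportional.
  obtain ⟨⟨a, c⟩, hac⟩ := Ell2.exists_apply_ne_zero (Ell2.ne_zero_of_norm_eq_one hψ₁)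
  obtain ⟨⟨b, d⟩, hbd⟩ := Ell2.exists_apply_ne_zero (Ell2.ne_zero_of_norm_eq_one hψ₂)
  obtain ⟨α₁, β₁, hα₁, hβ₁, rfl⟩ := exists_eq_prodVec hψ₁ (adjoint T₁ (T₂ (slice ψ₂ d)))
    fun y => ⟨adjoint T₂ (T₁ (slice ψ₁ y)) b / ψ₂ (b, d), by
      ext x
      change ψ₁ (x, y) = _ * adjoint T₁ (T₂ (slice ψ₂ d)) x
      rw [div_mul_eq_mul_div, eq_div_iff hbd, ← h, mul_comm]⟩
  obtain ⟨α₂, β₂, hα₂, hβ₂, rfl⟩ := exists_eq_prodVec hψ₂ (adjoint T₂ (T₁ (slice _ c)))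
    fun y => ⟨adjoint T₁ (T₂ (slice ψ₂ y)) a / prodVec α₁ β₁ (a, c), by
      ext x
      change ψ₂ (x, y) = _ * adjoint T₂ (T₁ (slice _ c)) x
      rw [div_mul_eq_mul_div, eq_div_iff hac, h, mul_comm]⟩
  have hc : β₁ c ≠ 0 := right_ne_zero_of_mul hac
  have hd : β₂ d ≠ 0 := right_ne_zero_of_mul hbd
  have ha : α₁ a ≠ 0 := left_ne_zero_of_mul hac
  have key : ∀ x₁ x₂, adjoint T₁ (T₂ α₂) x₁ * adjoint T₂ (T₁ α₁) x₂ = α₁ x₁ * α₂ x₂ := by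
    intro x₁ x₂
    have h1 := h x₁ c x₂ d
    simp only [slice_prodVec, map_smul, prodVec_apply] at h1
    have h2 : (β₂ d * adjoint T₁ (T₂ α₂) x₁) * (β₁ c * adjoint T₂ (T₁ α₁) x₂) =
      (α₁ x₁ * β₁ c) * (α₂ x₂ * β₂ d) := h1
    refine mul_left_cancel₀ (mul_ne_zero hc hd) ?_
    linear_combination h2
  have hvec : prodVec (adjoint T₁ (T₂ α₂)) (adjoint T₂ (T₁ α₁)) = prodVec α₁ α₂ := by
    ext p
    exact key p.1 p.2
  -- Both factors have norm at most one, and their product has norm one.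
  have hnorm := congrArg norm hvec
  rw [norm_prodVec, norm_prodVec, hα₁, hα₂, mul_one] at hnorm
  have n1 : ‖adjoint T₁ (T₂ α₂)‖ ≤ 1 := norm_adjoint_apply_le_one hT₁ hT₂ hα₂
  have n2 : ‖adjoint T₂ (T₁ α₁)‖ ≤ 1 := norm_adjoint_apply_le_one hT₂ hT₁ hα₁
  have n3 : ‖adjoint T₂ (T₁ α₁)‖ = 1 := by
    refine le_antisymm n2 ?_
    rw [← hnorm]
    exact mul_le_of_le_one_left (norm_nonneg _) n1
  -- The phase `z` moves from the first to the second factor of `ψ₂`.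
  set z : ℂ := adjoint T₁ (T₂ α₂) a / α₁ a with hz
  have hα₂z : α₂ = z • adjoint T₂ (T₁ α₁) := by
    ext x
    change α₂ x = z * adjoint T₂ (T₁ α₁) x
    rw [hz, div_mul_eq_mul_div, eq_div_iff ha, key, mul_comm]
  have hz1 : ‖z‖ = 1 := by
    have h1 := congrArg norm hα₂z
    rw [norm_smul, n3, mul_one, hα₂] at h1
    exact h1.symm
  refine ⟨α₁, β₁, adjoint T₂ (T₁ α₁), z • β₂, hα₁, hβ₁, n3, ?_,
    (apply_adjoint_apply_eq hT₁ hT₂ hα₁ n3).symm, rfl, ?_⟩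
  · rw [norm_smul, hz1, hβ₂, mul_one]
  · ext p
    have h1 : α₂ p.1 = z * adjoint T₂ (T₁ α₁) p.1 := congrArg (fun f : Ell2 X₂ => f p.1) hα₂z
    change α₂ p.1 * β₂ p.2 = adjoint T₂ (T₁ α₁) p.1 * (z * β₂ p.2)
    rw [h1]
    ring

/-! ### Tensor products over sets of variables -/

namespace ProgVars

variable {𝒱 : ProgVars.{u, v}}

namespace Splits

variable {X Y W X' W' : Set 𝒱.Var}

theorem slice_tensor (h : Splits X Y W) (ψ : 𝒱.Ell2V X) (φ : 𝒱.Ell2V Y) (y : 𝒱.types Y) :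
    slice (reindex h.memEquiv (h.tensor ψ φ)) y = φ y • ψ := by
  rw [← slice_prodVec]
  exact congrArg (slice · y) ((reindex h.memEquiv).apply_symm_apply (prodVec ψ φ))

theorem opTensor_tensor {Y' : Set 𝒱.Var} (h : Splits X Y W) (h' : Splits X' Y' W')
    (A : 𝒱.Ell2V X →L[ℂ] 𝒱.Ell2V X') (B : 𝒱.Ell2V Y →L[ℂ] 𝒱.Ell2V Y')
    (ψ : 𝒱.Ell2V X) (φ : 𝒱.Ell2V Y) :
    opTensor h h' A B (h.tensor ψ φ) = h'.tensor (A ψ) (B φ) :=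
  (eq_opTensor_iff h h' A B _).1 rfl ψ φ

theorem opTensor_id_apply (h : Splits X Y W) (h' : Splits X' Y W')
    (A : 𝒱.Ell2V X →L[ℂ] 𝒱.Ell2V X') (ξ : 𝒱.Ell2V W) (m : 𝒱.types W') :
    opTensor h h' A (ContinuousLinearMap.id ℂ (𝒱.Ell2V Y)) ξ m =
      A (slice (reindex h.memEquiv ξ) (h'.memEquiv m).2) (h'.memEquiv m).1 :=
  rfl

end Splits

/-! ### The operator defining the quantum equality -/

namespace QList

variable {n n₁ n₂ : ℕ}

theorem adjoint_unitary (Q : 𝒱.QList n) :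
    adjoint Q.unitary =
      ((reindex Q.memEquiv).symm : 𝒱.Ell2V Q.vars →L[ℂ] Ell2 Q.typel) :=
  LinearIsometryEquiv.adjoint_eq_symm _

theorem unitary_adjoint_apply (Q : 𝒱.QList n) (ψ : 𝒱.Ell2V Q.vars) :
    Q.unitary (adjoint Q.unitary ψ) = ψ := by
  rw [adjoint_unitary]
  exact (reindex Q.memEquiv).apply_symm_apply ψ

theorem norm_comp_adjoint_unitary_le {Z : Type*} (Q : 𝒱.QList n) (U : Ell2 Q.typel →L[ℂ] Ell2 Z) :
    ‖U ∘L adjoint Q.unitary‖ ≤ ‖U‖ := by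
  refine ContinuousLinearMap.opNorm_le_bound _ (norm_nonneg _) fun ψ => ?_
  have h : ‖adjoint Q.unitary ψ‖ = ‖ψ‖ := by
    rw [adjoint_unitary]
    exact (reindex Q.memEquiv).symm.norm_map ψ
  rw [← h]
  exact U.le_opNorm _

/-- The slice formula: although `ψ₁` and `ψ₂` need not be elementary tensors, their slices at the
variables outside `Q₁` and `Q₂` are mapped by `T₂* T₁` and `T₁* T₂`, where `Tᵢ = Uᵢ U_{Qᵢ}*`. -/
theorem swapOp_tensor_apply {Z : Type*} {W₁ W₂ W : Set 𝒱.Var} (hW : Splits W₁ W₂ W)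
    {Q₁ : 𝒱.QList n₁} {Q₂ : 𝒱.QList n₂} (hdisj : Disjoint Q₁.vars Q₂.vars)
    (hsub : Q₁.vars ∪ Q₂.vars ⊆ W) (h₁ : Q₁.vars ⊆ W₁) (h₂ : Q₂.vars ⊆ W₂)
    (U₁ : Ell2 Q₁.typel →L[ℂ] Ell2 Z) (U₂ : Ell2 Q₂.typel →L[ℂ] Ell2 Z)
    (ψ₁ : 𝒱.Ell2V W₁) (ψ₂ : 𝒱.Ell2V W₂) (m₁ : 𝒱.types W₁) (m₂ : 𝒱.types W₂) :
    swapOp W Q₁ Q₂ hdisj hsub U₁ U₂ (hW.tensor ψ₁ ψ₂) (hW.memEquiv.symm (m₁, m₂)) =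
      adjoint (U₁ ∘L adjoint Q₁.unitary) ((U₂ ∘L adjoint Q₂.unitary)
        (slice (reindex (Splits.of_subset h₂).memEquiv ψ₂)
          ((Splits.of_subset h₂).memEquiv m₂).2)) ((Splits.of_subset h₁).memEquiv m₁).1 *
      adjoint (U₂ ∘L adjoint Q₂.unitary) ((U₁ ∘L adjoint Q₁.unitary)
        (slice (reindex (Splits.of_subset h₁).memEquiv ψ₁)
          ((Splits.of_subset h₁).memEquiv m₁).2)) ((Splits.of_subset h₂).memEquiv m₂).1 := by
  obtain ⟨m, hm⟩ := hW.memEquiv.surjective (m₁, m₂)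
  rw [← hm, Equiv.symm_apply_apply]
  obtain ⟨rfl, rfl⟩ := Prod.mk.inj hm
  -- A slice of `ψ₁ ⊗ ψ₂` over the variables outside `Q₁ Q₂` is the tensor product of the slices.
  have hs : slice (reindex (Splits.of_subset hsub).memEquiv (hW.tensor ψ₁ ψ₂))
      ((Splits.of_subset hsub).memEquiv m).2 =
      (Splits.of_disjoint hdisj).tensor
        (slice (reindex (Splits.of_subset h₁).memEquiv ψ₁)
          ((Splits.of_subset h₁).memEquiv (hW.memEquiv m).1).2)
        (slice (reindex (Splits.of_subset h₂).memEquiv ψ₂)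
          ((Splits.of_subset h₂).memEquiv (hW.memEquiv m).2).2) := by
    ext q
    refine congrArg₂ (· * ·) (congrArg ψ₁ ?_) (congrArg ψ₂ ?_)
    · funext x
      by_cases hx : (x : 𝒱.Var) ∈ Q₁.vars
      · simp [Splits.memEquiv, hx]
      · have hx2 : (x : 𝒱.Var) ∉ Q₂.vars := fun h =>
          hW.disjoint.notMem_of_mem_left x.2 (h₂ h)
        simp [Splits.memEquiv, hx, hx2]
    · funext x
      by_cases hx : (x : 𝒱.Var) ∈ Q₂.vars
      · simp [Splits.memEquiv, hx]
      · have hx1 : (x : 𝒱.Var) ∉ Q₁.vars := fun h =>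
          hW.disjoint.notMem_of_mem_left (h₁ h) x.2
        simp [Splits.memEquiv, hx, hx1]
  rw [swapOp, Splits.opTensor_id_apply, hs, Splits.opTensor_tensor, adjoint_comp, adjoint_comp,
    adjoint_adjoint, adjoint_adjoint]
  exact mul_comm _ _

theorem factor_of_mem_fixed {Z : Type*} {W₁ W₂ W : Set 𝒱.Var} (hW : Splits W₁ W₂ W)
    {Q₁ : 𝒱.QList n₁} {Q₂ : 𝒱.QList n₂} (hdisj : Disjoint Q₁.vars Q₂.vars)
    (hsub : Q₁.vars ∪ Q₂.vars ⊆ W) (h₁ : Q₁.vars ⊆ W₁) (h₂ : Q₂.vars ⊆ W₂)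
    {U₁ : Ell2 Q₁.typel →L[ℂ] Ell2 Z} {U₂ : Ell2 Q₂.typel →L[ℂ] Ell2 Z}
    (hU₁ : ‖U₁‖ ≤ 1) (hU₂ : ‖U₂‖ ≤ 1)
    {ψ₁ : 𝒱.Ell2V W₁} {ψ₂ : 𝒱.Ell2V W₂} (hψ₁ : ‖ψ₁‖ = 1) (hψ₂ : ‖ψ₂‖ = 1)
    (h : swapOp W Q₁ Q₂ hdisj hsub U₁ U₂ (hW.tensor ψ₁ ψ₂) = hW.tensor ψ₁ ψ₂) :
    ∃ (ψ₁Q : 𝒱.Ell2V Q₁.vars) (ψ₁Y : 𝒱.Ell2V (W₁ \ Q₁.vars))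
      (ψ₂Q : 𝒱.Ell2V Q₂.vars) (ψ₂Y : 𝒱.Ell2V (W₂ \ Q₂.vars)),
      ‖ψ₁Q‖ = 1 ∧ ‖ψ₁Y‖ = 1 ∧ ‖ψ₂Q‖ = 1 ∧ ‖ψ₂Y‖ = 1 ∧
      U₁ (adjoint Q₁.unitary ψ₁Q) = U₂ (adjoint Q₂.unitary ψ₂Q) ∧
      ψ₁ = (Splits.of_subset h₁).tensor ψ₁Q ψ₁Y ∧
      ψ₂ = (Splits.of_subset h₂).tensor ψ₂Q ψ₂Y := by
  obtain ⟨α₁, β₁, α₂, β₂, hα₁, hβ₁, hα₂, hβ₂, hT, e₁, e₂⟩ :=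
    exists_prodVec_of_fixed
      (ψ₁ := reindex (Splits.of_subset h₁).memEquiv ψ₁)
      (ψ₂ := reindex (Splits.of_subset h₂).memEquiv ψ₂)
      (((reindex _).norm_map ψ₁).trans hψ₁) (((reindex _).norm_map ψ₂).trans hψ₂)
      ((norm_comp_adjoint_unitary_le Q₁ U₁).trans hU₁)
      ((norm_comp_adjoint_unitary_le Q₂ U₂).trans hU₂) (by
        intro x₁ y₁ x₂ y₂
        have hs := swapOp_tensor_apply hW hdisj hsub h₁ h₂ U₁ U₂ ψ₁ ψ₂
          ((Splits.of_subset h₁).memEquiv.symm (x₁, y₁))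
          ((Splits.of_subset h₂).memEquiv.symm (x₂, y₂))
        rw [h] at hs
        simp only [Equiv.apply_symm_apply] at hs
        rw [← hs, Splits.tensor, reindex_apply, Equiv.symm_symm, Equiv.apply_symm_apply]
        rfl)
  exact ⟨α₁, β₁, α₂, β₂, hα₁, hβ₁, hα₂, hβ₂, hT,
    (reindex (Splits.of_subset h₁).memEquiv).eq_symm_apply.2 e₁,
    (reindex (Splits.of_subset h₂).memEquiv).eq_symm_apply.2 e₂⟩

theorem swapOp_tensor_eq_self {Z : Type*} {W₁ W₂ W : Set 𝒱.Var} (hW : Splits W₁ W₂ W)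
    {Q₁ : 𝒱.QList n₁} {Q₂ : 𝒱.QList n₂} (hdisj : Disjoint Q₁.vars Q₂.vars)
    (hsub : Q₁.vars ∪ Q₂.vars ⊆ W) (h₁ : Q₁.vars ⊆ W₁) (h₂ : Q₂.vars ⊆ W₂)
    {U₁ : Ell2 Q₁.typel →L[ℂ] Ell2 Z} {U₂ : Ell2 Q₂.typel →L[ℂ] Ell2 Z}
    (hU₁ : adjoint U₁ ∘L U₁ = ContinuousLinearMap.id ℂ (Ell2 Q₁.typel))
    (hU₂ : adjoint U₂ ∘L U₂ = ContinuousLinearMap.id ℂ (Ell2 Q₂.typel))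
    {ψ₁Q : 𝒱.Ell2V Q₁.vars} {ψ₂Q : 𝒱.Ell2V Q₂.vars}
    (h : U₁ (adjoint Q₁.unitary ψ₁Q) = U₂ (adjoint Q₂.unitary ψ₂Q))
    (ψ₁Y : 𝒱.Ell2V (W₁ \ Q₁.vars)) (ψ₂Y : 𝒱.Ell2V (W₂ \ Q₂.vars)) :
    swapOp W Q₁ Q₂ hdisj hsub U₁ U₂ (hW.tensor ((Splits.of_subset h₁).tensor ψ₁Q ψ₁Y)
      ((Splits.of_subset h₂).tensor ψ₂Q ψ₂Y)) =
      hW.tensor ((Splits.of_subset h₁).tensor ψ₁Q ψ₁Y)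
        ((Splits.of_subset h₂).tensor ψ₂Q ψ₂Y) := by
  have key : ∀ {k l : ℕ} {Q : 𝒱.QList k} {Q' : 𝒱.QList l} {U : Ell2 Q.typel →L[ℂ] Ell2 Z}
      {U' : Ell2 Q'.typel →L[ℂ] Ell2 Z},
      adjoint U ∘L U = ContinuousLinearMap.id ℂ (Ell2 Q.typel) →
      ∀ {ψ : 𝒱.Ell2V Q.vars} {ψ' : 𝒱.Ell2V Q'.vars},
      U (adjoint Q.unitary ψ) = U' (adjoint Q'.unitary ψ') →
      adjoint (U ∘L adjoint Q.unitary) ((U' ∘L adjoint Q'.unitary) ψ') = ψ := by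
    intro k l Q Q' U U' hU ψ ψ' he
    rw [adjoint_comp, adjoint_adjoint, ContinuousLinearMap.comp_apply,
      ContinuousLinearMap.comp_apply, ← he, ← ContinuousLinearMap.comp_apply (adjoint U) U, hU]
    exact unitary_adjoint_apply Q ψ
  ext m
  obtain ⟨⟨m₁, m₂⟩, rfl⟩ := hW.memEquiv.symm.surjective m
  rw [swapOp_tensor_apply hW hdisj hsub h₁ h₂, Splits.slice_tensor, Splits.slice_tensor, map_smul, map_smul,
    map_smul, map_smul, key hU₁ h, key hU₂ h.symm]
  conv_rhs => rw [Splits.tensor, reindex_apply, Equiv.symm_symm, Equiv.apply_symm_apply]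
  change (_ * ψ₁Q _) * (_ * ψ₂Q _) = (ψ₁Q _ * _) * (ψ₂Q _ * _)
  simp only [Equiv.symm_symm]
  ring

/-! ### Lists of equal types -/

/-- In terms of lists, `U_σ` is the identity of `ℓ²` of the common type of the two lists. -/
theorem adjoint_unitary_eq_idTypel_iff {Q₁ Q₂ : 𝒱.QList n}
    (htyp : ∀ i, 𝒱.typ (Q₁.get i) = 𝒱.typ (Q₂.get i))
    (φ : 𝒱.Ell2V Q₁.vars) (ψ : 𝒱.Ell2V Q₂.vars) :
    adjoint Q₁.unitary φ = idTypel htyp (adjoint Q₂.unitary ψ) ↔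
      φ = (toRenaming Q₁ Q₂ htyp).unitary ψ := by
  have hσ : (toRenaming Q₁ Q₂ htyp).unitary ψ =
      Q₁.unitary (idTypel htyp (adjoint Q₂.unitary ψ)) := by
    rw [adjoint_unitary]
    ext m
    let e : Q₁.typel ≃ Q₂.typel := (Equiv.piCongrRight fun i => Equiv.cast (htyp i).symm).symm
    have hm : (toRenaming Q₁ Q₂ htyp).memEquiv.symm m =
        Q₂.memEquiv (e (Q₁.memEquiv.symm m)) := by
      obtain ⟨q, rfl⟩ := Q₁.memEquiv.surjective m
      rw [Equiv.symm_apply_eq, Equiv.symm_apply_apply]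
      funext x
      obtain ⟨y, rfl⟩ := (toRenaming Q₁ Q₂ htyp).toEquiv.surjective x
      obtain ⟨i, rfl⟩ := Q₂.idx.surjective y
      rw [Renaming.memEquiv_apply]
      -- The two sides are `q i` up to transport between equal types.
      refine eq_of_heq ((congr_arg_heq (Q₁.memEquiv q) (toRenaming_apply Q₁ Q₂ htyp i)).trans ?_)
      exact (heq_of_eq (memEquiv_apply Q₁ q i)).trans ((cast_heq _ _).trans
        ((heq_of_eq (memEquiv_apply Q₂ (e q) i)).trans (cast_heq _ _))).symm
    exact congrArg ψ hm
  rw [hσ]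
  constructor
  · intro h
    rw [← h, unitary_adjoint_apply]
  · rintro rfl
    rw [adjoint_unitary]
    exact (reindex Q₁.memEquiv).symm_apply_apply _

/-- `idTypel` is an isometry. -/
theorem adjoint_idTypel_comp {Q₁ Q₂ : 𝒱.QList n}
    (htyp : ∀ i, 𝒱.typ (Q₁.get i) = 𝒱.typ (Q₂.get i)) :
    adjoint (idTypel htyp) ∘L idTypel htyp = ContinuousLinearMap.id ℂ (Ell2 Q₂.typel) := by
  rw [idTypel, LinearIsometryEquiv.adjoint_eq_symm]
  ext1 ψ
  exact (reindex (Equiv.piCongrRight fun i => Equiv.cast (htyp i).symm)).symm_apply_apply ψ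

end QList

end ProgVars

end QRHL

theorem mainTheorem4 (𝒱 : QRHL.ProgVars.{u, v}) (V₁ V₂ : Set 𝒱.Var) (hV : Disjoint V₁ V₂)
    (ψ₁ : 𝒱.Ell2V (𝒱.qu V₁)) (ψ₂ : 𝒱.Ell2V (𝒱.qu V₂)) (hψ₁ : ‖ψ₁‖ = 1) (hψ₂ : ‖ψ₂‖ = 1) :
    -- the general case
    (∀ (n₁ n₂ : ℕ) (Q₁ : 𝒱.QList n₁) (Q₂ : 𝒱.QList n₂)
      (h₁ : Q₁.vars ⊆ 𝒱.qu V₁) (h₂ : Q₂.vars ⊆ 𝒱.qu V₂) (Z : Type w)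
      (U₁ : QRHL.Ell2 Q₁.typel →L[ℂ] QRHL.Ell2 Z) (U₂ : QRHL.Ell2 Q₂.typel →L[ℂ] QRHL.Ell2 Z),
      ‖U₁‖ ≤ 1 → ‖U₂‖ ≤ 1 →
      ((QRHL.ProgVars.qu_splits hV).tensor ψ₁ ψ₂ ∈
          QRHL.ProgVars.QList.quantEq (V₁ ∪ V₂) Q₁ Q₂ (QRHL.ProgVars.qlist_disjoint hV h₁ h₂)
            (QRHL.ProgVars.qlist_subset hV h₁ h₂) U₁ U₂ →
        ∃ (ψ₁Q : 𝒱.Ell2V Q₁.vars) (ψ₁Y : 𝒱.Ell2V (𝒱.qu V₁ \ Q₁.vars))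
          (ψ₂Q : 𝒱.Ell2V Q₂.vars) (ψ₂Y : 𝒱.Ell2V (𝒱.qu V₂ \ Q₂.vars)),
          ‖ψ₁Q‖ = 1 ∧ ‖ψ₁Y‖ = 1 ∧ ‖ψ₂Q‖ = 1 ∧ ‖ψ₂Y‖ = 1 ∧
          U₁ (adjoint Q₁.unitary ψ₁Q) = U₂ (adjoint Q₂.unitary ψ₂Q) ∧
          ψ₁ = (QRHL.ProgVars.Splits.of_subset h₁).tensor ψ₁Q ψ₁Y ∧
          ψ₂ = (QRHL.ProgVars.Splits.of_subset h₂).tensor ψ₂Q ψ₂Y) ∧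
      (adjoint U₁ ∘L U₁ = ContinuousLinearMap.id ℂ (QRHL.Ell2 Q₁.typel) →
        adjoint U₂ ∘L U₂ = ContinuousLinearMap.id ℂ (QRHL.Ell2 Q₂.typel) →
        (∃ (ψ₁Q : 𝒱.Ell2V Q₁.vars) (ψ₁Y : 𝒱.Ell2V (𝒱.qu V₁ \ Q₁.vars))
          (ψ₂Q : 𝒱.Ell2V Q₂.vars) (ψ₂Y : 𝒱.Ell2V (𝒱.qu V₂ \ Q₂.vars)),
          ‖ψ₁Q‖ = 1 ∧ ‖ψ₁Y‖ = 1 ∧ ‖ψ₂Q‖ = 1 ∧ ‖ψ₂Y‖ = 1 ∧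
          U₁ (adjoint Q₁.unitary ψ₁Q) = U₂ (adjoint Q₂.unitary ψ₂Q) ∧
          ψ₁ = (QRHL.ProgVars.Splits.of_subset h₁).tensor ψ₁Q ψ₁Y ∧
          ψ₂ = (QRHL.ProgVars.Splits.of_subset h₂).tensor ψ₂Q ψ₂Y) →
        (QRHL.ProgVars.qu_splits hV).tensor ψ₁ ψ₂ ∈
          QRHL.ProgVars.QList.quantEq (V₁ ∪ V₂) Q₁ Q₂ (QRHL.ProgVars.qlist_disjoint hV h₁ h₂)
            (QRHL.ProgVars.qlist_subset hV h₁ h₂) U₁ U₂)) ∧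
    -- the special case `Q₁ ≡q Q₂`
    (∀ (n : ℕ) (Q₁ Q₂ : 𝒱.QList n)
      (htyp : ∀ i, 𝒱.typ (Q₁.get i) = 𝒱.typ (Q₂.get i))
      (h₁ : Q₁.vars ⊆ 𝒱.qu V₁) (h₂ : Q₂.vars ⊆ 𝒱.qu V₂),
      (QRHL.ProgVars.qu_splits hV).tensor ψ₁ ψ₂ ∈
          QRHL.ProgVars.QList.quantEqSimple (V₁ ∪ V₂) Q₁ Q₂ htyp
            (QRHL.ProgVars.qlist_disjoint hV h₁ h₂) (QRHL.ProgVars.qlist_subset hV h₁ h₂) ↔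
        ∃ (ψ₁Q : 𝒱.Ell2V Q₁.vars) (ψ₁Y : 𝒱.Ell2V (𝒱.qu V₁ \ Q₁.vars))
          (ψ₂Q : 𝒱.Ell2V Q₂.vars) (ψ₂Y : 𝒱.Ell2V (𝒱.qu V₂ \ Q₂.vars)),
          ‖ψ₁Q‖ = 1 ∧ ‖ψ₁Y‖ = 1 ∧ ‖ψ₂Q‖ = 1 ∧ ‖ψ₂Y‖ = 1 ∧
          ψ₁Q = (QRHL.ProgVars.QList.toRenaming Q₁ Q₂ htyp).unitary ψ₂Q ∧
          ψ₁ = (QRHL.ProgVars.Splits.of_subset h₁).tensor ψ₁Q ψ₁Y ∧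
          ψ₂ = (QRHL.ProgVars.Splits.of_subset h₂).tensor ψ₂Q ψ₂Y) := by
  refine ⟨fun n₁ n₂ Q₁ Q₂ h₁ h₂ Z U₁ U₂ hU₁ hU₂ => ⟨fun h => ?_, ?_⟩,
    fun n Q₁ Q₂ htyp h₁ h₂ => ⟨fun h => ?_, ?_⟩⟩
  · exact QRHL.ProgVars.QList.factor_of_mem_fixed _ _ _ h₁ h₂ hU₁ hU₂ hψ₁ hψ₂ h
  · rintro i₁ i₂ ⟨ψ₁Q, ψ₁Y, ψ₂Q, ψ₂Y, -, -, -, -, he, rfl, rfl⟩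
    exact QRHL.ProgVars.QList.swapOp_tensor_eq_self _ _ _ h₁ h₂ i₁ i₂ he ψ₁Y ψ₂Y
  · obtain ⟨ψ₁Q, ψ₁Y, ψ₂Q, ψ₂Y, k₁, k₂, k₃, k₄, he, e₁, e₂⟩ :=
      QRHL.ProgVars.QList.factor_of_mem_fixed _ _ _ h₁ h₂
        ContinuousLinearMap.norm_id_le (LinearIsometry.norm_toContinuousLinearMap_le
          (LinearIsometryEquiv.toLinearIsometry _)) hψ₁ hψ₂ h
    exact ⟨ψ₁Q, ψ₁Y, ψ₂Q, ψ₂Y, k₁, k₂, k₃, k₄,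
      (QRHL.ProgVars.QList.adjoint_unitary_eq_idTypel_iff htyp ψ₁Q ψ₂Q).1 he, e₁, e₂⟩
  · rintro ⟨ψ₁Q, ψ₁Y, ψ₂Q, ψ₂Y, -, -, -, -, he, rfl, rfl⟩
    exact QRHL.ProgVars.QList.swapOp_tensor_eq_self _ _ _ h₁ h₂
      (by rw [← ContinuousLinearMap.one_def, ← star_eq_adjoint, star_one]; rfl)
      (QRHL.ProgVars.QList.adjoint_idTypel_comp htyp)
      ((QRHL.ProgVars.QList.adjoint_unitary_eq_idTypel_iff htyp ψ₁Q ψ₂Q).2 he) ψ₁Y ψ₂Y
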